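/- Notation: $(z)_n=z(z+1)\cdots(z+n-1)$, $(z)_0=1$. For top and bottom parameters $\alpha_0,\dots,\alpha_p$ and $\beta_1,\dots,\beta_p$ with $-\beta_i\notin\mathbb N_0$, ${}_{p+1}F_p(\alpha;\beta;z)$ denotes the holomorphic function on $\mathbb C\setminus[1,\infty)$ whose values for $|z|<1$ are $\sum_{n\ge0}\frac{(\alpha_0)_n\cdots(\alpha_p)_n}{(\beta_1)_n\cdots(\beta_p)_n\,n!}z^n$. Let $m_1,\dots,m_r$ be positive integers, $m=m_1+\dots+m_r$, $a,b\in\mathbb C$, $\mathbf f=(f_1,\dots,f_r)\in\mathbb C^r$ with $-f_i\notin\mathbb N_0$, and write $\mathbf f+\mathbf m=(f_1+m_1,\dots,f_r+m_r)$, $(\mathbf f)_{\mathbf m}=(f_1)_{m_1}\cdots(f_r)_{m_r}$. Define $\sigma_j$ by $(f_1+x)_{m_1}\cdots(f_r+x)_{m_r}=\sum_{j=0}^m\sigma_jx^j$ and put $$C_k=\frac1{(\mathbf f)_{\mathbf m}}\sum_{j=k}^m\sigma_j\,S(j,k),\qquad 0\le k\le m,$$ with $S(j,k)$ the Stirling numbers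 of the second kind. For $q\in\{0,\dots,m-1\}$ let $$R_{m-q-1}(t)=\sum_{k=0}^m(b)_kC_k(-1)^k(1-t-k)_{m-q-1},\qquad Q_m^0(-l)=\frac1{(-q)_l}\sum_{k=0}^l(b)_kC_k(-l)_k(m-q)_{l-k}\quad(0\le l\le q).$$ Let $\lambda=(\lambda_1,\dots,\lambda_d)$ be the zeros of $R_{m-q-1}$ with multiplicity, $d=\deg R_{m-q-1}$ (with $d=0$ and $\lambda$ empty if $R_{m-q-1}$ vanishes identically). **Theorem.** Suppose $q\in\{0,\dots,m-1\}$, $b+m-q\notin-\mathbb N_0$, and $f_j-b\notin\{m-q-m_j,m-q-m_j+1,\dots,0\}$ for every $j\in\{1,\dots,r\}$ with $m-q-m_j\le0$. Suppose also that the bottom parameters $\lambda_i+q+1$ below are not in $-\mathbb N_0$. Then both hypergeometric functions below exist as holomorphic functions on $\mathbb C\setminus[1,\infty)$, and for all $x\in\mathbb C\setminus[1,\infty)$, with the principal branch of $(1-x)^a$, $$(1-x)^a\,{}_{r+2}F_{r+1}\!\left(\begin{matrix}a,\,b,\,\mathbf f+\mathbf m\\ b+m-q,\,\mathbf f\end{matrix};x\right)=\sum_{j=0}^q\frac{(a)_j(-q)_jQ_m^0(-j)}{(b+m-q)_j\,j!}\left(\frac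 x{x-1}\right)^j$$ $$\qquad+\frac{x^{q+1}(a)_{q+1}R_{m-q-1}(-q-1)}{(x-1)^{q+1}(b+m-q)_{q+1}(m-q-1)!}\;{}_{d+2}F_{d+1}\!\left(\begin{matrix}1,\,a+q+1,\,\lambda+q+2\\ b+m+1,\,\lambda+q+1\end{matrix};\frac x{x-1}\right).$$ The polynomial $R_{m-q-1}$ has degree at most $m-q-1$, with equality if and only if $f_j-b\notin\{1-m_j,\dots,-1,0\}$ for all $j$; in that case the function on the right is an ${}_{m-q+1}F_{m-q}$. Moreover $$R_{m-q-1}(-q-1)=(-1)^{m-q+1}\sum_{k=0}^{q+1}(b)_kC_k(-1)^k(k-m)_{m-q-1},$$ and, for $0\le l\le q$, $Q_m^0(-l)=\lim_{\varepsilon\to0}Q_m(b,\,b+m-q+\varepsilon,\,\mathbf f\,|\,{-l})$, where $$Q_m(b,c,\mathbf f\,|\,t)=\frac1{(c-b-m)_m}\sum_{k=0}^m(b)_kC_k(t)_k(c-b-m-t)_{m-k}.$$ -/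

import Mathlib

open scoped Topology

noncomputable section

/-- The Pochhammer symbol `(z)_n = z (z+1) ⋯ (z+n-1)`. -/
def poch (z : ℂ) (n : ℕ) : ℂ := (ascPochhammer ℂ n).eval z

/-- The coefficient of `z ^ n` in the generalized hypergeometric series with top parameters `A` and
bottom parameters `B`. -/
def hypCoeff (A B : Multiset ℂ) (n : ℕ) : ℂ :=
  (A.map fun α => poch α n).prod / ((B.map fun β => poch β n).prod * (n.factorial : ℂ))

/-- The cut plane `ℂ ∖ [1,∞)`. -/
def cutPlane : Set ℂ := {z : ℂ | ¬ ∃ s : ℝ, 1 ≤ s ∧ z = (s : ℂ)}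

/-- `F` is the analytic continuation to `ℂ ∖ [1,∞)` of the generalized hypergeometric series with
top parameters `A` and bottom parameters `B`: it is holomorphic in the cut plane and it is the sum
of the series in the open unit disc. By the identity theorem this determines `F` on the cut
plane. -/
def IsHypContinuation (A B : Multiset ℂ) (F : ℂ → ℂ) : Prop :=
  DifferentiableOn ℂ F cutPlane ∧
    ∀ z : ℂ, ‖z‖ < 1 → HasSum (fun n : ℕ => hypCoeff A B n * z ^ n) (F z)

open scoped Classical in
/-- The generalized hypergeometric function `_{p+1}F_p(A; B; z)`, where `A` lists the `p + 1` top
and `B` the `p` bottom parameters: the analytic continuation of the hypergeometric series to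
`ℂ ∖ [1,∞)`. -/
def pFq (A B : Multiset ℂ) (z : ℂ) : ℂ :=
  if h : ∃ F : ℂ → ℂ, IsHypContinuation A B F then h.choose z
  else ∑' n : ℕ, hypCoeff A B n * z ^ n

/-- The product `(f)_m = (f_1)_{m_1} ⋯ (f_r)_{m_r}`. -/
def pochProd {r : ℕ} (f : Fin r → ℂ) (m : Fin r → ℕ) : ℂ := ∏ i, poch (f i) (m i)

/-- The number `σ_j`, the coefficient of `x ^ j` in `(f_1+x)_{m_1} ⋯ (f_r+x)_{m_r}`. -/
def sigmaCoeff {r : ℕ} (f : Fin r → ℂ) (m : Fin r → ℕ) (j : ℕ) : ℂ :=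
  (∏ i, (ascPochhammer ℂ (m i)).comp (Polynomial.C (f i) + Polynomial.X)).coeff j

/-- The number `C_{k,r} = (1 / (f)_m) ∑_{j=k}^{m} σ_j S(j,k)`, with the Stirling numbers of the
second kind `S(j,k)`. -/
def Ccoeff {r : ℕ} (f : Fin r → ℂ) (m : Fin r → ℕ) (k : ℕ) : ℂ :=
  (1 / pochProd f m) *
    ∑ j ∈ Finset.Icc k (∑ i, m i), sigmaCoeff f m j * (Nat.stirlingSecond j k : ℂ)

/-- The characteristic polynomial `Q_m(b, c, f | t)`. -/
def charQ {r : ℕ} (b c : ℂ) (f : Fin r → ℂ) (m : Fin r → ℕ) (t : ℂ) : ℂ :=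
  (1 / poch (c - b - ((∑ i, m i : ℕ) : ℂ)) (∑ i, m i)) *
    ∑ k ∈ Finset.range ((∑ i, m i) + 1),
      poch b k * Ccoeff f m k * poch t k *
        poch (c - b - ((∑ i, m i : ℕ) : ℂ) - t) ((∑ i, m i) - k)

/-- The number `Q_m^0(-l)`, for `0 ≤ l ≤ q`. -/
def charQzero {r : ℕ} (q : ℕ) (b : ℂ) (f : Fin r → ℂ) (m : Fin r → ℕ) (l : ℕ) : ℂ :=
  (1 / poch (-(q : ℂ)) l) *
    ∑ k ∈ Finset.range (l + 1),
      poch b k * Ccoeff f m k * poch (-(l : ℂ)) k * poch (((∑ i, m i : ℕ) : ℂ) - q) (l - k)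

/-- The reduced polynomial
`R_{m-q-1}(t) = ∑_{k=0}^{m} (b)_k C_{k,r} (-1)^k (1-t-k)_{m-q-1}`. -/
def reducedR {r : ℕ} (q : ℕ) (b : ℂ) (f : Fin r → ℂ) (m : Fin r → ℕ) : Polynomial ℂ :=
  ∑ k ∈ Finset.range ((∑ i, m i) + 1),
    Polynomial.C (poch b k * Ccoeff f m k * (-1) ^ k) *
      (ascPochhammer ℂ ((∑ i, m i) - q - 1)).comp
        (Polynomial.C (1 - (k : ℂ)) - Polynomial.X)

/-- The top parameters `a, b, f + m` of the hypergeometric function to be transformed. -/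
def lhsTop {r : ℕ} (a b : ℂ) (f : Fin r → ℂ) (m : Fin r → ℕ) : Multiset ℂ :=
  a ::ₘ b ::ₘ Finset.univ.val.map fun i => f i + (m i : ℂ)

/-- The bottom parameters `b + m - q, f` of the hypergeometric function to be transformed. -/
def lhsBot {r : ℕ} (q : ℕ) (b : ℂ) (f : Fin r → ℂ) (m : Fin r → ℕ) : Multiset ℂ :=
  (b + ((∑ i, m i : ℕ) : ℂ) - q) ::ₘ Finset.univ.val.map f

/-- The top parameters `1, a + q + 1, λ + q + 2`, where `λ` lists the zeros of the reduced
polynomial with their multiplicities. -/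
def rhsTop {r : ℕ} (q : ℕ) (a b : ℂ) (f : Fin r → ℂ) (m : Fin r → ℕ) : Multiset ℂ :=
  1 ::ₘ (a + q + 1) ::ₘ (reducedR q b f m).roots.map fun l => l + (q : ℂ) + 2

/-- The bottom parameters `b + m + 1, λ + q + 1`, where `λ` lists the zeros of the reduced
polynomial with their multiplicities. -/
def rhsBot {r : ℕ} (q : ℕ) (b : ℂ) (f : Fin r → ℂ) (m : Fin r → ℕ) : Multiset ℂ :=
  (b + ((∑ i, m i : ℕ) : ℂ) + 1) ::ₘ (reducedR q b f m).roots.map fun l => l + (q : ℂ) + 1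

end

/-!
Since `(f + m)_n / (f)_n = (f + n)_m / (f)_m` is a polynomial in `n`, the numbers `C_k` are its
coefficients with respect to the falling factorials `(-1)^k (-n)_k` (`pochProd_add_div`). With
`c = b + m - q`, the function on the left is therefore `∑ (a)_n (b)_n / ((c)_n n!) P(n) x^n` with
`P(n) = ∑ C_k (-1)^k (-n)_k`.

Pfaff's substitution `x = y / (y - 1)` turns `(1 - x)^a ∑ c_n x^n` into a power series in `y`, for
small `y`, by the binomial series and absolute convergence (`hasSum_pfaff`). The Chu–Vandermonde
identity with a falling factorial inserted (`sum_choose_poch_falling`) evaluates its `N`-th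
coefficient as `(a)_N / ((c)_N N!) ∑ C_k (-N)_k (b)_k (m - q)_{N-k}` (`sum_hypCoeff_lhs`). For
`N ≤ q` the sum is `(-q)_N Q_m^0(-N)`, which gives the finite sum on the right. For `N > q` it is a
multiple of `R_{m-q-1}(-N)` (`sum_poch_eq_eval_reducedR`); factoring `R_{m-q-1}` into its linear
factors shows that these values are `R_{m-q-1}(-q-1)` times the quotients of Pochhammer symbols of
`λ + q + 2` and `λ + q + 1` (`eval_mul_prod_roots`), which gives the hypergeometric function on the
right. So both sides agree near `0`. Both are holomorphic in the cut plane, which is star-shaped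
with respect to `0` and stable under the involution `x ↦ x / (x - 1)`, so the identity theorem
extends the formula (`pfaff_transformation`).

The continuations exist for arbitrary parameters (`exists_isHypContinuation`): the binomial series
continues to the cut plane, and multiplication of the coefficients by `(b)_n / (c)_n` preserves
this property. For `0 < re b` and `0 < re (c - b)` this multiplication is Euler's integral
`∫ t^(b-1) (1-t)^(c-b-1) U(tz) dt`, up to a constant, and contiguous relations do the rest
(`exists_isCutContinuation_poch_div`).

Finally, the coefficient of `t^(m-q-1)` in `R_{m-q-1}` is, up to sign, the value at `n = -b` of the
polynomial above, `∏ (f_i - b)_{m_i} / (f)_m`, which decides when the degree drops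
(`coeff_reducedR`).
-/

/-! ### Pochhammer symbols -/

@[simp] lemma poch_zero (z : ℂ) : poch z 0 = 1 := by simp [poch]

lemma poch_succ (z : ℂ) (n : ℕ) : poch z (n + 1) = poch z n * (z + n) :=
  ascPochhammer_succ_eval n z

lemma poch_add (z : ℂ) (m n : ℕ) : poch z (m + n) = poch z m * poch (z + m) n := by
  simp [poch, ← ascPochhammer_mul]

lemma poch_succ' (z : ℂ) (n : ℕ) : poch z (n + 1) = z * poch (z + 1) n := by
  rw [add_comm n 1, poch_add, poch_succ]
  simp

lemma poch_eq_zero_iff (z : ℂ) (n : ℕ) : poch z n = 0 ↔ ∃ k < n, (k : ℂ) = -z :=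
  ascPochhammer_eval_eq_zero_iff n z

lemma poch_ne_zero {z : ℂ} (hz : ∀ n : ℕ, z ≠ -(n : ℂ)) (n : ℕ) : poch z n ≠ 0 := by
  rw [Ne, poch_eq_zero_iff]
  rintro ⟨k, -, hk⟩
  exact hz k (by rw [hk, neg_neg])

lemma poch_natCast_succ (d n : ℕ) :
    (d.factorial : ℂ) * poch ((d : ℂ) + 1) n = ((d + n).factorial : ℂ) := by
  induction n with
  | zero => simp
  | succ n ih =>
    rw [poch_succ, ← mul_assoc, ih, ← add_assoc, Nat.factorial_succ]
    push_cast
    ring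

lemma poch_one (n : ℕ) : poch 1 n = (n.factorial : ℂ) := by
  simpa using poch_natCast_succ 0 n

lemma poch_reflect (z : ℂ) (n : ℕ) : poch z n = (-1) ^ n * poch (1 - z - n) n := by
  induction n generalizing z with
  | zero => simp
  | succ n ih =>
    rw [poch_succ, poch_succ', ih]
    push_cast
    rw [show 1 - z - ((n : ℂ) + 1) + 1 = 1 - z - n by ring]
    ring

lemma poch_shift_div {z : ℂ} (hz : ∀ n : ℕ, z ≠ -(n : ℂ)) (n : ℕ) :
    poch (z + 1) n / poch z n = (z + n) / z := by
  have hz0 : z ≠ 0 := by simpa using hz 0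
  rw [div_eq_div_iff (poch_ne_zero hz n) hz0, mul_comm, ← poch_succ', poch_succ, mul_comm]

lemma add_ne_neg_natCast {z : ℂ} (hz : ∀ n : ℕ, z ≠ -(n : ℂ)) (k : ℕ) (n : ℕ) :
    z + k ≠ -(n : ℂ) := by
  intro h
  apply hz (k + n)
  push_cast
  linear_combination h

lemma norm_poch_le {z : ℂ} {K : ℕ} (hz : ‖z‖ ≤ K) (n : ℕ) :
    ‖poch z n‖ ≤ (n.factorial : ℝ) * 2 ^ (K + n) := by
  have h1 : ‖poch z n‖ ≤ (K.ascFactorial n : ℝ) := by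
    induction n with
    | zero => simp
    | succ n ih =>
      rw [poch_succ, norm_mul, Nat.ascFactorial_succ, mul_comm]
      push_cast
      gcongr
      exact (norm_add_le _ _).trans (by simpa using hz)
  refine h1.trans ?_
  rw [Nat.ascFactorial_eq_factorial_mul_choose']
  push_cast
  gcongr
  calc (((K + n - 1).choose n : ℕ) : ℝ) ≤ 2 ^ (K + n - 1) := mod_cast Nat.choose_le_two_pow _ _
    _ ≤ 2 ^ (K + n) := by gcongr <;> simp

/-! ### The cut plane -/

lemma mem_cutPlane_iff {z : ℂ} : z ∈ cutPlane ↔ 1 - z ∈ Complex.slitPlane := by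
  rw [Complex.mem_slitPlane_iff_not_le_zero, cutPlane, Set.mem_ofPred_eq, not_iff_not, iff_comm]
  constructor
  · intro h
    obtain ⟨h1, h2⟩ := Complex.le_def.1 h
    simp only [Complex.sub_re, Complex.one_re, Complex.zero_re, Complex.sub_im, Complex.one_im,
      Complex.zero_im] at h1 h2
    exact ⟨z.re, by linarith, Complex.ext (by simp) (by simp; linarith)⟩
  · rintro ⟨s, hs, rfl⟩
    rw [Complex.le_def]
    simp [hs]

lemma isOpen_cutPlane : IsOpen cutPlane := by
  have : cutPlane = (fun z : ℂ => 1 - z) ⁻¹' Complex.slitPlane := by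
    ext z
    exact mem_cutPlane_iff
  rw [this]
  exact Complex.isOpen_slitPlane.preimage (by fun_prop)

lemma mem_cutPlane_of_norm_lt_one {z : ℂ} (hz : ‖z‖ < 1) : z ∈ cutPlane := by
  rintro ⟨s, hs, rfl⟩
  rw [Complex.norm_real, Real.norm_eq_abs] at hz
  linarith [le_abs_self s]

lemma zero_mem_cutPlane : (0 : ℂ) ∈ cutPlane := mem_cutPlane_of_norm_lt_one (by simp)

lemma ne_one_of_mem_cutPlane {z : ℂ} (hz : z ∈ cutPlane) : z ≠ 1 := by
  rintro rfl
  exact hz ⟨1, le_rfl, by simp⟩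

lemma ofReal_mul_mem_cutPlane {z : ℂ} (hz : z ∈ cutPlane) {t : ℝ} (ht : t ∈ Set.Icc (0 : ℝ) 1) :
    (t : ℂ) * z ∈ cutPlane := by
  rintro ⟨s, hs, h⟩
  have ht0 : t ≠ 0 := by
    rintro rfl
    have : (s : ℂ) = 0 := by simpa using h.symm
    rw [Complex.ofReal_eq_zero] at this
    linarith
  have htpos : 0 < t := lt_of_le_of_ne ht.1 (Ne.symm ht0)
  refine hz ⟨s / t, ?_, ?_⟩
  · rw [le_div_iff₀ htpos]
    linarith [ht.2]
  · have : (t : ℂ) ≠ 0 := mod_cast ht0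
    push_cast
    rw [eq_div_iff this, ← h, mul_comm]

lemma isPreconnected_cutPlane : IsPreconnected cutPlane := by
  refine (StarConvex.isPathConnected (a := (0 : ℂ)) ?_
    zero_mem_cutPlane).isConnected.isPreconnected
  rw [starConvex_zero_iff]
  intro z hz t ht0 ht1
  simpa using ofReal_mul_mem_cutPlane hz ⟨ht0, ht1⟩

/-- The involution `x ↦ x / (x - 1)` maps the cut plane to itself. -/
lemma div_sub_one_mem_cutPlane {x : ℂ} (hx : x ∈ cutPlane) : x / (x - 1) ∈ cutPlane := by
  have h1 : x - 1 ≠ 0 := sub_ne_zero.2 (ne_one_of_mem_cutPlane hx)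
  rintro ⟨s, hs, h⟩
  rw [div_eq_iff h1] at h
  rcases hs.eq_or_lt with rfl | hs1
  · rw [Complex.ofReal_one, one_mul] at h
    exact one_ne_zero (α := ℂ) (by linear_combination h)
  · have h2 : ((s : ℂ) - 1) ≠ 0 := by
      rw [← Complex.ofReal_one, ← Complex.ofReal_sub]
      exact_mod_cast (sub_pos.2 hs1).ne'
    refine hx ⟨s / (s - 1), ?_, ?_⟩
    · rw [le_div_iff₀ (sub_pos.2 hs1)]
      linarith
    · push_cast
      rw [eq_div_iff h2]
      linear_combination -h

/-! ### Continuation of power series to the cut plane -/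

/-- `U` is holomorphic in `ℂ ∖ [1,∞)` and is the sum of the power series `∑ u n * z ^ n` in the
open unit disc. -/
def IsCutContinuation (u : ℕ → ℂ) (U : ℂ → ℂ) : Prop :=
  DifferentiableOn ℂ U cutPlane ∧ ∀ z : ℂ, ‖z‖ < 1 → HasSum (fun n => u n * z ^ n) (U z)

lemma IsCutContinuation.congr {u v : ℕ → ℂ} {U : ℂ → ℂ} (h : IsCutContinuation u U)
    (huv : ∀ n, u n = v n) : IsCutContinuation v U := by
  rwa [← show u = v from funext huv]

lemma IsCutContinuation.const_mul {u : ℕ → ℂ} {U : ℂ → ℂ} (h : IsCutContinuation u U) (c : ℂ) :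
    IsCutContinuation (fun n => c * u n) fun z => c * U z :=
  ⟨h.1.const_mul c, fun z hz => by simpa [mul_assoc] using (h.2 z hz).mul_left c⟩

lemma IsCutContinuation.add {u v : ℕ → ℂ} {U V : ℂ → ℂ} (h : IsCutContinuation u U)
    (h' : IsCutContinuation v V) : IsCutContinuation (fun n => u n + v n) fun z => U z + V z :=
  ⟨h.1.add h'.1, fun z hz => by simpa [add_mul] using (h.2 z hz).add (h'.2 z hz)⟩

lemma IsCutContinuation.coeff_eq {u : ℕ → ℂ} {U : ℂ → ℂ} (h : IsCutContinuation u U) (n : ℕ) :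
    u n = (n.factorial : ℂ)⁻¹ * iteratedDeriv n U 0 := by
  have key : ∀ v : ℕ → ℂ, (∀ z : ℂ, ‖z‖ < 1 → HasSum (fun n => v n * z ^ n) (U z)) →
      HasFPowerSeriesAt U (FormalMultilinearSeries.ofScalars ℂ v) 0 := by
    intro v hv
    rw [hasFPowerSeriesAt_iff']
    filter_upwards [Metric.ball_mem_nhds (0 : ℂ) one_pos] with z hz
    simpa [FormalMultilinearSeries.coeff_ofScalars, mul_comm] using hv z (by simpa using hz)
  have h2 := key (fun n => (n.factorial : ℂ)⁻¹ * iteratedDeriv n U 0) fun z hz => by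
    have := Complex.hasSum_taylorSeries_on_ball (f := U) (c := 0) (r := 1)
      (h.1.mono fun w hw => mem_cutPlane_of_norm_lt_one (by simpa using hw))
      (z := z) (by simpa using hz)
    simpa [mul_assoc, mul_comm, mul_left_comm] using this
  have h3 := congrArg (fun p => p.coeff n) ((key u h.2).eq_formalMultilinearSeries h2)
  simpa [FormalMultilinearSeries.coeff_ofScalars] using h3

/-- Euler's operator `z d/dz` multiplies the `n`-th coefficient by `n`. -/
lemma IsCutContinuation.euler {u : ℕ → ℂ} {U : ℂ → ℂ} (h : IsCutContinuation u U) :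
    IsCutContinuation (fun n => n * u n) fun z => z * deriv U z := by
  have hd : DifferentiableOn ℂ (deriv U) cutPlane := h.1.deriv isOpen_cutPlane
  refine ⟨differentiableOn_id.mul hd, fun z hz => ?_⟩
  have h1 := Complex.hasSum_taylorSeries_on_ball (f := deriv U) (c := 0) (r := 1)
    (hd.mono fun w hw => mem_cutPlane_of_norm_lt_one (by simpa using hw))
    (z := z) (by simpa using hz)
  rw [← hasSum_nat_add_iff' 1]
  simp only [Finset.range_one, Finset.sum_singleton, Nat.cast_zero, zero_mul, sub_zero]
  refine (h1.mul_left z).congr_fun ?_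
  intro n
  rw [h.coeff_eq, iteratedDeriv_succ', Nat.factorial_succ]
  have : ((n : ℂ) + 1) ≠ 0 := Nat.cast_add_one_ne_zero n
  push_cast
  simp only [sub_zero, smul_eq_mul]
  field_simp
  ring

/-- Division by `z` after removal of the constant term shifts the coefficients. -/
lemma IsCutContinuation.shift {u : ℕ → ℂ} {U : ℂ → ℂ} (h : IsCutContinuation u U) :
    IsCutContinuation (fun n => u (n + 1)) (dslope U 0) := by
  refine ⟨(Complex.differentiableOn_dslope
    (isOpen_cutPlane.mem_nhds zero_mem_cutPlane)).2 h.1, fun z hz => ?_⟩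
  rcases eq_or_ne z 0 with rfl | hz0
  · have h1 : dslope U 0 0 = u 1 := by simp [h.coeff_eq]
    rw [h1]
    convert hasSum_single (f := fun n => u (n + 1) * (0 : ℂ) ^ n) 0 ?_ using 1
    · simp
    · intro n hn
      simp [hn]
  · have h0 : U 0 = u 0 := by simp [h.coeff_eq]
    have h1 := (hasSum_nat_add_iff' 1).2 (h.2 z hz)
    rw [dslope_of_ne _ hz0, slope_def_field, h0, sub_zero]
    have h2 := h1.div_const z
    simp only [Finset.range_one, Finset.sum_singleton, pow_zero, mul_one] at h2
    refine h2.congr_fun fun n => ?_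
    field_simp
    ring

lemma IsCutContinuation.cons {u : ℕ → ℂ} {U : ℂ → ℂ} {v : ℕ → ℂ} (h : IsCutContinuation u U)
    (hv : ∀ n, v (n + 1) = u n) : IsCutContinuation v fun z => v 0 + z * U z := by
  refine ⟨(differentiableOn_const _).add (differentiableOn_id.mul h.1), fun z hz => ?_⟩
  rw [← hasSum_nat_add_iff' 1]
  simp only [Finset.range_one, Finset.sum_singleton, pow_zero, mul_one, add_sub_cancel_left]
  refine ((h.2 z hz).mul_left z).congr_fun fun n => ?_
  rw [hv, pow_succ]
  ring

/-! ### Continuation of generalized hypergeometric series -/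

open MeasureTheory in
/-- The integral transform `U ↦ ∫ w(t) U(tz) dt` over `[0,1]` preserves continuability to the cut
plane, which is star-shaped with respect to `0`, and multiplies the coefficients by the moments
of `w`. -/
lemma IsCutContinuation.moment {u : ℕ → ℂ} {U : ℂ → ℂ} (h : IsCutContinuation u U) {w : ℝ → ℂ}
    (hw : IntervalIntegrable w volume 0 1) :
    IsCutContinuation (fun n => (∫ t in (0 : ℝ)..1, w t * (t : ℂ) ^ n) * u n)
      fun z => ∫ t in (0 : ℝ)..1, w t * U (t * z) := by
  have hIoc : ∀ t : ℝ, t ∈ Set.uIoc (0 : ℝ) 1 → t ∈ Set.Icc (0 : ℝ) 1 := fun t ht => by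
    rw [Set.uIoc_of_le zero_le_one] at ht
    exact Set.Ioc_subset_Icc_self ht
  have hwm : AEStronglyMeasurable w (volume.restrict (Set.uIoc (0 : ℝ) 1)) :=
    (intervalIntegrable_iff.1 hw).aestronglyMeasurable
  have hcont : ∀ (V : ℂ → ℂ), ContinuousOn V cutPlane → ∀ z ∈ cutPlane,
      ContinuousOn (fun t : ℝ => V (t * z)) (Set.Icc 0 1) := fun V hV z hz =>
    hV.comp (by fun_prop) fun t ht => ofReal_mul_mem_cutPlane hz ht
  have hmeas : ∀ (V : ℂ → ℂ), ContinuousOn V cutPlane → ∀ z ∈ cutPlane,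
      AEStronglyMeasurable (fun t : ℝ => w t * V (t * z))
        (volume.restrict (Set.uIoc (0 : ℝ) 1)) := fun V hV z hz => by
    refine hwm.mul ?_
    rw [Set.uIoc_of_le zero_le_one]
    exact ((hcont V hV z hz).mono Set.Ioc_subset_Icc_self).aestronglyMeasurable measurableSet_Ioc
  have hint : ∀ (V : ℂ → ℂ), ContinuousOn V cutPlane → ∀ z ∈ cutPlane,
      IntervalIntegrable (fun t : ℝ => w t * V (t * z)) volume 0 1 := fun V hV z hz =>
    hw.mul_continuousOn (by rw [Set.uIcc_of_le zero_le_one]; exact hcont V hV z hz)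
  have hd : DifferentiableOn ℂ (deriv U) cutPlane := h.1.deriv isOpen_cutPlane
  refine ⟨fun z₀ hz₀ => ?_, fun z hz => ?_⟩
  · obtain ⟨r, hr, hball⟩ := Metric.nhds_basis_closedBall.mem_iff.1 (isOpen_cutPlane.mem_nhds hz₀)
    have hc : ContinuousOn (fun p : ℝ × ℂ => (p.1 : ℂ) * deriv U (p.1 * p.2))
        (Set.Icc 0 1 ×ˢ Metric.closedBall z₀ r) := by
      refine ContinuousOn.mul (by fun_prop) (hd.continuousOn.comp (by fun_prop) ?_)
      rintro ⟨t, z⟩ ⟨ht, hz⟩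
      exact ofReal_mul_mem_cutPlane (hball hz) ht
    obtain ⟨C, hC⟩ :=
      (isCompact_Icc.prod (isCompact_closedBall z₀ r)).exists_bound_of_continuousOn hc
    refine (intervalIntegral.hasDerivAt_integral_of_dominated_loc_of_deriv_le
      (F := fun z t => w t * U (t * z)) (F' := fun z t => w t * ((t : ℂ) * deriv U (t * z)))
      (bound := fun t => ‖w t‖ * C)
      (s := Metric.closedBall z₀ r) (Metric.closedBall_mem_nhds z₀ hr) ?_ ?_ ?_ ?_ ?_
      ?_).2.differentiableAt.differentiableWithinAt
    · filter_upwards [isOpen_cutPlane.mem_nhds hz₀] with z hz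
      exact hmeas U h.1.continuousOn z hz
    · exact hint U h.1.continuousOn z₀ hz₀
    · have := (hmeas (deriv U) hd.continuousOn z₀ hz₀).mul
        (Complex.continuous_ofReal.aestronglyMeasurable (μ := volume.restrict (Set.uIoc (0 : ℝ) 1)))
      refine this.congr (Filter.Eventually.of_forall fun t => ?_)
      simp only [Pi.mul_apply]
      ring
    · refine Filter.Eventually.of_forall fun t ht z hz => ?_
      rw [norm_mul]
      gcongr
      exact hC (t, z) ⟨hIoc t ht, hz⟩
    · exact hw.norm.mul_const C
    · refine Filter.Eventually.of_forall fun t ht z hz => ?_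
      have h1 : HasDerivAt U (deriv U (t * z)) (t * z) :=
        (h.1.differentiableAt (isOpen_cutPlane.mem_nhds
          (ofReal_mul_mem_cutPlane (hball hz) (hIoc t ht)))).hasDerivAt
      have h2 : HasDerivAt (fun z : ℂ => (t : ℂ) * z) t z := by
        simpa using (hasDerivAt_id z).const_mul (t : ℂ)
      have h3 := (h1.comp z h2).const_mul (w t)
      rwa [mul_comm (deriv U _)] at h3
  · have hs : Summable fun n => ‖u n * z ^ n‖ := (h.2 z hz).summable.norm
    have key := intervalIntegral.hasSum_integral_of_dominated_convergence (μ := volume)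
      (a := 0) (b := 1) (F := fun n t => w t * (u n * (t * z) ^ n)) (f := fun t => w t * U (t * z))
      (fun n t => ‖w t‖ * ‖u n * z ^ n‖) ?_ ?_ ?_ ?_ ?_
    · refine key.congr_fun fun n => ?_
      rw [mul_assoc, ← intervalIntegral.integral_mul_const]
      congr 1
      funext t
      rw [mul_pow]
      ring
    · intro n
      exact hwm.mul (by fun_prop)
    · refine fun n => Filter.Eventually.of_forall fun t ht => ?_
      obtain ⟨ht0, ht1⟩ := hIoc t ht
      rw [norm_mul, norm_mul (u n), norm_mul (u n), norm_pow, norm_pow, norm_mul,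
        Complex.norm_real, Real.norm_of_nonneg ht0]
      gcongr
      exact mul_le_of_le_one_left (norm_nonneg z) ht1
    · exact Filter.Eventually.of_forall fun t _ => hs.mul_left _
    · simp_rw [tsum_mul_left]
      exact hw.norm.mul_const _
    · refine Filter.Eventually.of_forall fun t ht => ?_
      obtain ⟨ht0, ht1⟩ := hIoc t ht
      refine (h.2 (t * z) ?_).mul_left (w t)
      rw [norm_mul, Complex.norm_real, Real.norm_of_nonneg ht0]
      exact (mul_le_of_le_one_left (norm_nonneg z) ht1).trans_lt hz

lemma integral_beta_moment {b c : ℂ} (hb : 0 < b.re) (hcb : 0 < (c - b).re) (n : ℕ) :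
    ∫ t in (0 : ℝ)..1, ((t : ℂ) ^ (b - 1) * (1 - (t : ℂ)) ^ (c - b - 1)) * (t : ℂ) ^ n =
      Complex.betaIntegral b (c - b) * (poch b n / poch c n) := by
  have hbn : 0 < (b + n).re := by
    simp only [Complex.add_re, Complex.natCast_re]
    positivity
  have hc : 0 < c.re := by
    rw [Complex.sub_re] at hcb
    linarith
  have hne : ∀ z : ℂ, 0 < z.re → ∀ k : ℕ, z ≠ -(k : ℂ) := by
    rintro z hz k rfl
    simp only [Complex.neg_re, Complex.natCast_re] at hz
    linarith [(Nat.cast_nonneg k : (0 : ℝ) ≤ k)]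
  have hG : ∀ z : ℂ, 0 < z.re → Complex.Gamma (z + n) = Complex.Gamma z * poch z n := by
    intro z hz
    rw [poch, ← Complex.Gamma_add_nat_div_Gamma_eq z (hne z hz),
      mul_div_cancel₀ _ (Complex.Gamma_ne_zero_of_re_pos hz)]
  have h1 : ∫ t in (0 : ℝ)..1, ((t : ℂ) ^ (b - 1) * (1 - (t : ℂ)) ^ (c - b - 1)) * (t : ℂ) ^ n =
      Complex.betaIntegral (b + n) (c - b) := by
    rw [Complex.betaIntegral]
    refine intervalIntegral.integral_congr_ae (Filter.Eventually.of_forall fun t ht => ?_)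
    rw [Set.uIoc_of_le zero_le_one] at ht
    have ht0 : (t : ℂ) ≠ 0 := mod_cast ht.1.ne'
    rw [show b + n - 1 = b - 1 + n by ring, Complex.cpow_add _ _ ht0, Complex.cpow_natCast]
    ring
  rw [h1, Complex.betaIntegral_eq_Gamma_mul_div _ _ hbn hcb,
    Complex.betaIntegral_eq_Gamma_mul_div _ _ hb hcb, hG b hb,
    show b + n + (c - b) = c + n by ring, show b + (c - b) = c by ring, hG c hc]
  have := Complex.Gamma_ne_zero_of_re_pos hc
  have := poch_ne_zero (hne c hc) n
  field_simp

/-- If `∑ u n * z ^ n` continues to the cut plane, then so does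
`∑ (b)_n / (c)_n * u n * z ^ n`. For `0 < re b` and `0 < re (c - b)` this is Euler's integral; the
contiguous relations reduce the general case to this one. -/
lemma exists_isCutContinuation_poch_div {u : ℕ → ℂ} {U : ℂ → ℂ} (h : IsCutContinuation u U)
    (b c : ℂ) (hc : ∀ n : ℕ, c ≠ -(n : ℂ)) :
    ∃ V, IsCutContinuation (fun n => poch b n / poch c n * u n) V := by
  have euler : ∀ (u : ℕ → ℂ) (U : ℂ → ℂ) (b c : ℂ), IsCutContinuation u U → 0 < b.re →
      0 < (c - b).re → ∃ V, IsCutContinuation (fun n => poch b n / poch c n * u n) V := by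
    intro u U b c h hb hcb
    have hB : Complex.betaIntegral b (c - b) ≠ 0 := by
      rw [Complex.betaIntegral_eq_Gamma_mul_div _ _ hb hcb]
      have hc : 0 < (b + (c - b)).re := by
        rw [Complex.add_re]
        linarith
      exact div_ne_zero (mul_ne_zero (Complex.Gamma_ne_zero_of_re_pos hb)
        (Complex.Gamma_ne_zero_of_re_pos hcb)) (Complex.Gamma_ne_zero_of_re_pos hc)
    refine ⟨_, ((h.moment (Complex.betaIntegral_convergent hb hcb)).const_mul
      (Complex.betaIntegral b (c - b))⁻¹).congr fun n => ?_⟩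
    rw [integral_beta_moment hb hcb]
    field_simp
  -- `(c)_{n+1} = c (c+1)_n` raises `c` at the cost of one application of Euler's operator.
  have raise : ∀ (N : ℕ) (u : ℕ → ℂ) (U : ℂ → ℂ) (b c : ℂ), IsCutContinuation u U →
      (∀ n : ℕ, c ≠ -(n : ℂ)) → 0 < b.re → 0 < (c + N - b).re →
      ∃ V, IsCutContinuation (fun n => poch b n / poch c n * u n) V := by
    intro N
    induction N with
    | zero =>
      intro u U b c h _ hb hcb
      exact euler u U b c h hb (by simpa using hcb)
    | succ N ih =>
      intro u U b c h hc hb hcb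
      have hc0 : c ≠ 0 := by simpa using hc 0
      have hc1 : ∀ n : ℕ, c + 1 ≠ -(n : ℂ) := by simpa using add_ne_neg_natCast hc 1
      obtain ⟨V, hV⟩ := ih u U b (c + 1) h hc1 hb (by
        convert hcb using 2
        push_cast
        ring)
      refine ⟨_, (hV.add (hV.euler.const_mul c⁻¹)).congr fun n => ?_⟩
      have h1 := poch_shift_div hc n
      have h2 := poch_ne_zero hc n
      have h3 := poch_ne_zero hc1 n
      field_simp at h1 ⊢
      linear_combination -poch b n * u n * h1
  -- Splitting off the constant term raises `b` and `c` simultaneously.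
  have both : ∀ (N : ℕ) (u : ℕ → ℂ) (U : ℂ → ℂ) (b c : ℂ), IsCutContinuation u U →
      (∀ n : ℕ, c ≠ -(n : ℂ)) → 0 < (b + N).re →
      ∃ V, IsCutContinuation (fun n => poch b n / poch c n * u n) V := by
    intro N
    induction N with
    | zero =>
      intro u U b c h hc hb
      obtain ⟨N, hN⟩ := exists_nat_gt (b - c).re
      refine raise N u U b c h hc (by simpa using hb) ?_
      simp only [Complex.sub_re, Complex.add_re, Complex.natCast_re] at hN ⊢
      linarith
    | succ N ih =>
      intro u U b c h hc hb
      obtain ⟨V, hV⟩ := ih _ _ (b + 1) (c + 1) h.shift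
        (by simpa using add_ne_neg_natCast hc 1) (by
        convert hb using 2
        push_cast
        ring)
      refine ⟨_, (hV.const_mul (b / c)).cons fun n => ?_⟩
      rw [poch_succ', poch_succ', mul_div_mul_comm, mul_assoc]
  obtain ⟨N, hN⟩ := exists_nat_gt (-b.re)
  refine both N u U b c h hc ?_
  simp only [Complex.add_re, Complex.natCast_re]
  linarith

lemma choose_eq_poch_div (a : ℂ) (n : ℕ) :
    Ring.choose (a + n - 1) n = poch a n / (n.factorial : ℂ) := by
  have h := Ring.factorial_nsmul_multichoose_eq_ascPochhammer a n
  rw [Polynomial.ascPochhammer_smeval_eq_eval, nsmul_eq_mul] at h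
  have h1 : Ring.choose (a + n - 1) n = Ring.multichoose a n := by
    rw [Ring.choose]
    congr 1
    ring
  rw [h1, poch, ← h, mul_div_cancel_left₀ _ (Nat.cast_ne_zero.2 n.factorial_ne_zero)]

/-- The binomial series `∑ (a)_n / n! * z ^ n`. -/
lemma isCutContinuation_binomial (a : ℂ) :
    IsCutContinuation (fun n => poch a n / (n.factorial : ℂ)) fun z => 1 / (1 - z) ^ a := by
  refine ⟨fun z hz => ?_, fun z hz => ?_⟩
  · have h1 := mem_cutPlane_iff.1 hz
    refine (DifferentiableAt.div (by fun_prop) ?_ ?_).differentiableWithinAt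
    · exact (DifferentiableAt.cpow (by fun_prop) (by fun_prop) h1)
    · simp [Complex.cpow_eq_zero_iff, Complex.slitPlane_ne_zero h1]
  · have := (Complex.one_div_one_sub_cpow_hasFPowerSeriesOnBall_zero a).hasSum (y := z)
      (by simpa [← ENNReal.ofReal_one, Metric.eball_ofReal] using hz)
    simpa [choose_eq_poch_div, mul_comm] using this

lemma hypCoeff_cons_cons (A B : Multiset ℂ) (α β : ℂ) (n : ℕ) :
    hypCoeff (α ::ₘ A) (β ::ₘ B) n = poch α n / poch β n * hypCoeff A B n := by
  simp only [hypCoeff, Multiset.map_cons, Multiset.prod_cons]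
  rw [mul_assoc, mul_div_mul_comm]

lemma exists_isHypContinuation (A B : Multiset ℂ) (hAB : A.card = B.card + 1)
    (hB : ∀ β ∈ B, ∀ n : ℕ, β ≠ -(n : ℂ)) : ∃ F, IsHypContinuation A B F := by
  induction B using Multiset.induction generalizing A with
  | empty =>
    obtain ⟨α, rfl⟩ := Multiset.card_eq_one.1 (by simpa using hAB)
    refine ⟨_, (isCutContinuation_binomial α).congr fun n => ?_⟩
    simp [hypCoeff]
  | cons β B ih =>
    obtain ⟨α, A, rfl⟩ := Multiset.card_pos_iff_exists_mem.1 (by omega : 0 < A.card) |>.imp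
      fun α hα => Multiset.exists_cons_of_mem hα
    obtain ⟨F, hF⟩ := ih A (by simpa using hAB) fun b hb => hB b (Multiset.mem_cons_of_mem hb)
    obtain ⟨V, hV⟩ := exists_isCutContinuation_poch_div (u := hypCoeff A B) hF α β
      (hB β (Multiset.mem_cons_self β B))
    exact ⟨V, IsCutContinuation.congr hV fun n => (hypCoeff_cons_cons A B α β n).symm⟩

lemma isHypContinuation_pFq (A B : Multiset ℂ) (hAB : A.card = B.card + 1)
    (hB : ∀ β ∈ B, ∀ n : ℕ, β ≠ -(n : ℂ)) : IsHypContinuation A B (pFq A B) := by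
  have h := exists_isHypContinuation A B hAB hB
  have : pFq A B = h.choose := by
    funext z
    rw [pFq, dif_pos h]
  rw [this]
  exact h.choose_spec

/-! ### The coefficients `C_k` and Chu–Vandermonde sums -/

/-- Monomials in terms of the falling factorials `x (x-1) ⋯ (x-k+1) = (-1)^k (-x)_k`. -/
lemma pow_eq_sum_stirlingSecond (x : ℂ) (j : ℕ) :
    x ^ j = ∑ k ∈ Finset.range (j + 1), (j.stirlingSecond k : ℂ) * ((-1) ^ k * poch (-x) k) := by
  induction j with
  | zero => simp
  | succ j ih =>
    have hstep : ∀ k : ℕ, x * ((-1) ^ k * poch (-x) k) =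
        (-1) ^ (k + 1) * poch (-x) (k + 1) + k * ((-1) ^ k * poch (-x) k) := by
      intro k
      rw [poch_succ]
      ring
    rw [pow_succ', ih, Finset.mul_sum, Finset.sum_range_succ' _ (j + 1)]
    simp only [Nat.stirlingSecond_succ_zero, Nat.cast_zero, zero_mul, add_zero]
    have hrec : ∀ k : ℕ, ((j + 1).stirlingSecond (k + 1) : ℂ) =
        ((k + 1 : ℕ) : ℂ) * (j.stirlingSecond (k + 1) : ℂ) + (j.stirlingSecond k : ℂ) := by
      intro k
      rw [Nat.stirlingSecond_succ_succ, Nat.cast_add, Nat.cast_mul]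
    simp only [hrec, add_mul, Finset.sum_add_distrib]
    have h2 : ∑ k ∈ Finset.range (j + 1), ((k + 1 : ℕ) : ℂ) * (j.stirlingSecond (k + 1) : ℂ) *
        ((-1) ^ (k + 1) * poch (-x) (k + 1)) =
        ∑ k ∈ Finset.range (j + 1), (k : ℂ) * (j.stirlingSecond k : ℂ) *
        ((-1) ^ k * poch (-x) k) := by
      have h3 := Finset.sum_range_succ' (fun k => (k : ℂ) * (j.stirlingSecond k : ℂ) *
        ((-1) ^ k * poch (-x) k)) (j + 1)
      rw [Finset.sum_range_succ] at h3
      simpa [Nat.stirlingSecond_eq_zero_of_lt (Nat.lt_succ_self j)] using h3.symm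
    rw [h2, ← Finset.sum_add_distrib]
    refine Finset.sum_congr rfl fun k _ => ?_
    linear_combination (j.stirlingSecond k : ℂ) * hstep k

lemma natDegree_pochProd_le {r : ℕ} (f : Fin r → ℂ) (m : Fin r → ℕ) :
    (∏ i, (ascPochhammer ℂ (m i)).comp (Polynomial.C (f i) + Polynomial.X)).natDegree ≤
      ∑ i, m i := by
  refine (Polynomial.natDegree_prod_le _ _).trans (Finset.sum_le_sum fun i _ => ?_)
  rw [Polynomial.natDegree_comp, ascPochhammer_natDegree, add_comm, Polynomial.natDegree_X_add_C,
    mul_one]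

/-- The defining property of the numbers `C_k`: they expand `∏ (f_i + x)_{m_i} / (f)_m` in falling
factorials of `x`. -/
lemma pochProd_add_div {r : ℕ} (f : Fin r → ℂ) (m : Fin r → ℕ) (x : ℂ) :
    pochProd (fun i => f i + x) m / pochProd f m =
      ∑ k ∈ Finset.range ((∑ i, m i) + 1), Ccoeff f m k * ((-1) ^ k * poch (-x) k) := by
  have h1 : pochProd (fun i => f i + x) m =
      ∑ j ∈ Finset.range ((∑ i, m i) + 1), sigmaCoeff f m j * x ^ j := by
    have := Polynomial.eval_eq_sum_range' (Nat.lt_succ_of_le (natDegree_pochProd_le f m)) x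
    rw [Polynomial.eval_prod] at this
    simpa [pochProd, poch, sigmaCoeff] using this
  rw [h1, div_eq_mul_one_div, mul_comm, Finset.mul_sum]
  simp only [Ccoeff, Finset.mul_sum, Finset.sum_mul]
  simp_rw [pow_eq_sum_stirlingSecond x, Finset.mul_sum]
  rw [Finset.sum_comm' (t' := Finset.range ((∑ i, m i) + 1))
    (s' := fun k => Finset.Icc k (∑ i, m i))]
  · refine Finset.sum_congr rfl fun k _ => Finset.sum_congr rfl fun j _ => ?_
    ring
  · intro j k
    simp only [Finset.mem_range, Finset.mem_Icc]
    omega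

lemma poch_neg_natCast_of_lt {N k : ℕ} (h : N < k) : poch (-(N : ℂ)) k = 0 :=
  (poch_eq_zero_iff _ _).2 ⟨N, h, by simp⟩

/-- The Chu–Vandermonde identity in polynomial form. -/
lemma sum_choose_poch (b c : ℂ) (N : ℕ) :
    ∑ n ∈ Finset.range (N + 1), (N.choose n : ℂ) * (-1) ^ n * poch b n * poch (c + n) (N - n) =
      poch (c - b) N := by
  induction N generalizing b c with
  | zero => simp
  | succ N ih =>
    have h1 : ∑ n ∈ Finset.range (N + 1 + 1), ((N + 1).choose n : ℂ) * (-1) ^ n * poch b n *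
        poch (c + n) (N + 1 - n) =
        (c + N) * (∑ n ∈ Finset.range (N + 1), (N.choose n : ℂ) * (-1) ^ n * poch b n *
          poch (c + n) (N - n)) -
        b * ∑ n ∈ Finset.range (N + 1), (N.choose n : ℂ) * (-1) ^ n * poch (b + 1) n *
          poch (c + 1 + n) (N - n) := by
      have h2 : (c + N) * (∑ n ∈ Finset.range (N + 1), (N.choose n : ℂ) * (-1) ^ n * poch b n *
          poch (c + n) (N - n)) = ∑ n ∈ Finset.range (N + 1 + 1), (N.choose n : ℂ) * (-1) ^ n *
          poch b n * poch (c + n) (N + 1 - n) := by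
        rw [Finset.sum_range_succ _ (N + 1), Nat.choose_succ_self, Finset.mul_sum]
        simp only [Nat.cast_zero, zero_mul, add_zero]
        refine Finset.sum_congr rfl fun n hn => ?_
        have hn : n ≤ N := Nat.lt_succ_iff.1 (Finset.mem_range.1 hn)
        rw [Nat.succ_sub hn, poch_succ, Nat.cast_sub hn]
        ring
      rw [h2, Finset.sum_range_succ' _ (N + 1), Finset.sum_range_succ' _ (N + 1), Finset.mul_sum]
      simp only [Nat.choose_succ_succ, Nat.cast_add, add_mul, Finset.sum_add_distrib,
        Nat.choose_zero_right]
      have h3 : ∑ n ∈ Finset.range (N + 1), (N.choose n : ℂ) * (-1) ^ (n + 1) * poch b (n + 1) *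
          poch (c + ((n : ℂ) + (1 : ℕ))) (N + 1 - (n + 1)) =
          -∑ n ∈ Finset.range (N + 1), b * ((N.choose n : ℂ) * (-1) ^ n * poch (b + 1) n *
          poch (c + 1 + n) (N - n)) := by
        rw [← Finset.sum_neg_distrib]
        refine Finset.sum_congr rfl fun n _ => ?_
        rw [poch_succ', Nat.add_sub_add_right, Nat.cast_one,
          show c + ((n : ℂ) + 1) = c + 1 + n by ring]
        ring
      rw [h3]
      ring
    rw [h1, ih, ih, poch_succ, show c + 1 - (b + 1) = c - b by ring]
    ring

/-- The Chu–Vandermonde identity with a falling factorial of the summation index inserted. -/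
lemma sum_choose_poch_falling (b c : ℂ) (N k : ℕ) :
    ∑ n ∈ Finset.range (N + 1), (N.choose n : ℂ) * (-1) ^ n * poch b n * poch (c + n) (N - n) *
        ((-1) ^ k * poch (-(n : ℂ)) k) =
      poch (-(N : ℂ)) k * poch b k * poch (c - b) (N - k) := by
  induction k generalizing N b c with
  | zero => simpa using sum_choose_poch b c N
  | succ k ih =>
    rcases N with _ | N
    · simp [poch_succ']
    · have h1 : ∑ n ∈ Finset.range (N + 1 + 1), ((N + 1).choose n : ℂ) * (-1) ^ n * poch b n *
          poch (c + n) (N + 1 - n) * ((-1) ^ (k + 1) * poch (-(n : ℂ)) (k + 1)) =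
          -(N + 1) * b * ∑ n ∈ Finset.range (N + 1), (N.choose n : ℂ) * (-1) ^ n *
            poch (b + 1) n * poch (c + 1 + n) (N - n) * ((-1) ^ k * poch (-(n : ℂ)) k) := by
        rw [Finset.sum_range_succ', Finset.mul_sum]
        have h0 : poch (-((0 : ℕ) : ℂ)) (k + 1) = 0 := by simp [poch_succ']
        rw [h0, mul_zero, mul_zero, add_zero]
        refine Finset.sum_congr rfl fun n _ => ?_
        have hc : ((N : ℂ) + 1) * (N.choose n : ℂ) = ((N + 1).choose (n + 1) : ℂ) * (n + 1) := by
          exact_mod_cast Nat.add_one_mul_choose_eq N n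
        rw [poch_succ', poch_succ' (-((n + 1 : ℕ) : ℂ)), Nat.add_sub_add_right, Nat.cast_add_one,
          show c + ((n : ℂ) + 1) = c + 1 + n by ring, show -((n : ℂ) + 1) + 1 = -n by ring]
        linear_combination (-1) ^ n * b * poch (b + 1) n * poch (c + 1 + n) (N - n) *
          (-1) ^ k * poch (-(n : ℂ)) k * hc
      rw [h1, ih, poch_succ' b, poch_succ' (-((N + 1 : ℕ) : ℂ)), Nat.add_sub_add_right,
        Nat.cast_add_one, show c + 1 - (b + 1) = c - b by ring,
        show -((N : ℂ) + 1) + 1 = -N by ring]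
      ring

/-! ### The reduced polynomial -/

lemma eval_reducedR {r : ℕ} (q : ℕ) (b : ℂ) (f : Fin r → ℂ) (m : Fin r → ℕ) (t : ℂ) :
    (reducedR q b f m).eval t = ∑ k ∈ Finset.range ((∑ i, m i) + 1),
      poch b k * Ccoeff f m k * (-1) ^ k * poch (1 - t - k) ((∑ i, m i) - q - 1) := by
  simp only [reducedR, Polynomial.eval_finsetSum, Polynomial.eval_mul, Polynomial.eval_C,
    Polynomial.eval_comp, Polynomial.eval_sub, Polynomial.eval_X, poch]
  refine Finset.sum_congr rfl fun k _ => ?_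
  rw [sub_right_comm]

lemma poch_neg_natCast {k N : ℕ} (h : k ≤ N) :
    poch (-(N : ℂ)) k * ((N - k).factorial : ℂ) = (-1) ^ k * (N.factorial : ℂ) := by
  obtain ⟨d, rfl⟩ := Nat.exists_eq_add_of_le h
  rw [poch_reflect, Nat.add_sub_cancel_left, mul_assoc]
  congr 1
  have := poch_natCast_succ d k
  rw [show 1 - -((k + d : ℕ) : ℂ) - k = d + 1 by push_cast; ring, mul_comm, this, add_comm]

/-- Beyond the index `q`, the numerators produced by the Chu–Vandermonde identity are values of the
reduced polynomial. -/
lemma sum_poch_eq_eval_reducedR {r : ℕ} {q : ℕ} (b : ℂ) (f : Fin r → ℂ) (m : Fin r → ℕ)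
    (hq : q < ∑ i, m i) {N : ℕ} (hN : q + 1 ≤ N) :
    (∑ k ∈ Finset.range ((∑ i, m i) + 1), Ccoeff f m k *
      (poch (-(N : ℂ)) k * poch b k * poch (((∑ i, m i : ℕ) : ℂ) - q) (N - k))) *
        (((∑ i, m i) - q - 1).factorial : ℂ) =
      (N.factorial : ℂ) * (reducedR q b f m).eval (-(N : ℂ)) := by
  rw [eval_reducedR, Finset.sum_mul, Finset.mul_sum]
  set M := ∑ i, m i
  obtain ⟨s, hs⟩ : ∃ s, M = q + 1 + s := Nat.exists_eq_add_of_le hq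
  have hs' : M - q - 1 = s := by omega
  refine Finset.sum_congr rfl fun k hk => ?_
  have hk : k ≤ M := Nat.lt_succ_iff.1 (Finset.mem_range.1 hk)
  rw [hs']
  rcases le_or_gt k N with hkN | hkN
  · have h1 := poch_neg_natCast hkN
    obtain ⟨d, rfl⟩ := Nat.exists_eq_add_of_le hkN
    have h2 := poch_natCast_succ d s
    have h3 := poch_natCast_succ s d
    rw [Nat.add_sub_cancel_left] at h1 ⊢
    have hd : (d.factorial : ℂ) ≠ 0 := Nat.cast_ne_zero.2 d.factorial_ne_zero
    rw [hs, show 1 - -((k + d : ℕ) : ℂ) - k = d + 1 by push_cast; ring,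
      show ((q + 1 + s : ℕ) : ℂ) - q = s + 1 by push_cast; ring]
    apply mul_right_cancel₀ hd
    rw [add_comm s d, ← h2] at h3
    linear_combination Ccoeff f m k * poch b k * (poch ((s : ℂ) + 1) d * s.factorial * h1 +
      (-1) ^ k * ((k + d).factorial : ℂ) * h3)
  -- for `N < k ≤ M` both sides vanish
  · rw [poch_neg_natCast_of_lt hkN, (poch_eq_zero_iff _ s).2 ⟨k - N - 1, by omega, ?_⟩]
    · simp
    · rw [Nat.cast_sub (by omega), Nat.cast_sub hkN.le]
      push_cast
      ring

lemma eval_reducedR_neg_sub_one {r : ℕ} {q : ℕ} (b : ℂ) (f : Fin r → ℂ) (m : Fin r → ℕ)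
    (hq : q < ∑ i, m i) :
    (reducedR q b f m).eval (-(q : ℂ) - 1) = (-1) ^ ((∑ i, m i) - q + 1) *
      ∑ k ∈ Finset.range (q + 2), poch b k * Ccoeff f m k * (-1) ^ k *
        poch ((k : ℂ) - ((∑ i, m i : ℕ) : ℂ)) ((∑ i, m i) - q - 1) := by
  rw [eval_reducedR]
  set M := ∑ i, m i
  obtain ⟨s, hs⟩ : ∃ s, M = q + 1 + s := Nat.exists_eq_add_of_le hq
  rw [show M - q - 1 = s by omega, show M - q + 1 = s + 2 by omega, Finset.mul_sum]
  rw [← Finset.sum_subset (Finset.range_mono (by omega : q + 2 ≤ M + 1))]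
  · refine Finset.sum_congr rfl fun k _ => ?_
    rw [poch_reflect (1 - (-(q : ℂ) - 1) - k), hs,
      show 1 - (1 - (-(q : ℂ) - 1) - k) - s = k - ((q + 1 + s : ℕ) : ℂ) by push_cast; ring]
    ring
  -- the terms with `q + 2 ≤ k ≤ M` vanish
  · intro k hk hk'
    simp only [Finset.mem_range, not_lt] at hk hk'
    rw [(poch_eq_zero_iff _ s).2 ⟨k - (q + 2), by omega, ?_⟩, mul_zero]
    rw [Nat.cast_sub hk']
    push_cast
    ring

lemma natDegree_comp_C_sub_X (n : ℕ) (z : ℂ) :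
    ((ascPochhammer ℂ n).comp (Polynomial.C z - Polynomial.X)).natDegree = n := by
  rw [Polynomial.natDegree_comp, ascPochhammer_natDegree, ← Polynomial.natDegree_neg, neg_sub,
    Polynomial.natDegree_X_sub_C, mul_one]

lemma natDegree_reducedR_le {r : ℕ} (q : ℕ) (b : ℂ) (f : Fin r → ℂ) (m : Fin r → ℕ) :
    (reducedR q b f m).natDegree ≤ (∑ i, m i) - q - 1 :=
  Polynomial.natDegree_sum_le_of_forall_le _ _ fun _ _ =>
    (Polynomial.natDegree_C_mul_le _ _).trans (natDegree_comp_C_sub_X _ _).le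

/-- The top coefficient is a value of the polynomial expanded in `pochProd_add_div`, because
`(-1)^k (b)_k` is the `k`-th falling factorial of `-b`. -/
lemma coeff_reducedR {r : ℕ} (q : ℕ) (b : ℂ) (f : Fin r → ℂ) (m : Fin r → ℕ) :
    (reducedR q b f m).coeff ((∑ i, m i) - q - 1) =
      (-1) ^ ((∑ i, m i) - q - 1) * (pochProd (fun i => f i - b) m / pochProd f m) := by
  have h1 : ∀ (n : ℕ) (z : ℂ),
      ((ascPochhammer ℂ n).comp (Polynomial.C z - Polynomial.X)).coeff n = (-1) ^ n := by
    intro n z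
    have hX : (Polynomial.C z - Polynomial.X : Polynomial ℂ).natDegree = 1 := by
      rw [← Polynomial.natDegree_neg, neg_sub, Polynomial.natDegree_X_sub_C]
    have h2 := Polynomial.leadingCoeff_comp (p := ascPochhammer ℂ n)
      (q := Polynomial.C z - Polynomial.X) (by rw [hX]; exact one_ne_zero)
    rw [Polynomial.leadingCoeff, natDegree_comp_C_sub_X, (monic_ascPochhammer ℂ n).leadingCoeff,
      ascPochhammer_natDegree, Polynomial.leadingCoeff, hX] at h2
    rw [h2]
    simp
  have h2 := pochProd_add_div f m (-b)
  simp only [neg_neg, ← sub_eq_add_neg] at h2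
  rw [h2, reducedR, Polynomial.finsetSum_coeff, Finset.mul_sum]
  refine Finset.sum_congr rfl fun k _ => ?_
  rw [Polynomial.coeff_C_mul, h1]
  ring

lemma pochProd_ne_zero {r : ℕ} {f : Fin r → ℂ} (hf : ∀ i, ∀ n : ℕ, f i ≠ -(n : ℂ))
    (m : Fin r → ℕ) : pochProd f m ≠ 0 :=
  Finset.prod_ne_zero_iff.2 fun i _ => poch_ne_zero (hf i) (m i)

lemma degree_reducedR_eq_iff {r : ℕ} (q : ℕ) (b : ℂ) {f : Fin r → ℂ} (m : Fin r → ℕ)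
    (hf : ∀ i, ∀ n : ℕ, f i ≠ -(n : ℂ)) :
    (reducedR q b f m).degree = (((∑ i, m i) - q - 1 : ℕ) : WithBot ℕ) ↔
      ∀ j, ∀ i : ℕ, i < m j → f j - b ≠ -(i : ℂ) := by
  have h1 : (reducedR q b f m).degree = (((∑ i, m i) - q - 1 : ℕ) : WithBot ℕ) ↔
      (reducedR q b f m).coeff ((∑ i, m i) - q - 1) ≠ 0 := by
    constructor
    · exact fun h => Polynomial.coeff_ne_zero_of_eq_degree h
    · exact fun h => Polynomial.degree_eq_of_le_of_coeff_ne_zero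
        (Polynomial.natDegree_le_iff_degree_le.1 (natDegree_reducedR_le q b f m)) h
  rw [h1, coeff_reducedR, mul_ne_zero_iff, and_iff_right (pow_ne_zero _ (by norm_num)),
    div_ne_zero_iff, and_iff_left (pochProd_ne_zero hf m), pochProd, Finset.prod_ne_zero_iff]
  simp only [Finset.mem_univ, true_imp_iff, Ne, poch_eq_zero_iff, not_exists, not_and]
  refine forall_congr' fun j => forall_congr' fun i => forall_congr' fun _ => ?_
  rw [not_iff_not, eq_comm, neg_eq_iff_eq_neg]

/-- The ratio of the Pochhammer products attached to the zeros of a polynomial interpolates its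
values along an arithmetic progression. -/
lemma eval_mul_prod_roots (P : Polynomial ℂ) (z : ℂ)
    (hP : ∀ l ∈ P.roots, ∀ n : ℕ, l + z ≠ -(n : ℂ)) (s : ℕ) :
    P.eval (-z) * (((P.roots.map fun l => poch (l + z + 1) s).prod) /
      (P.roots.map fun l => poch (l + z) s).prod) = P.eval (-z - s) := by
  have h : ∀ t, P.eval t = P.leadingCoeff * (P.roots.map fun l => t - l).prod := by
    intro t
    conv_lhs => rw [(IsAlgClosed.splits P).eq_prod_roots]
    simp [Polynomial.eval_multiset_prod, Multiset.map_map]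
  rw [h, h, mul_assoc, ← Multiset.prod_map_div, ← Multiset.prod_map_mul]
  congr 2
  refine Multiset.map_congr rfl fun l hl => ?_
  have hl0 : l + z ≠ 0 := by simpa using hP l hl 0
  rw [poch_shift_div (hP l hl)]
  field_simp
  ring

/-! ### The characteristic polynomial -/

lemma poch_mul_charQzero {r : ℕ} {q : ℕ} (b : ℂ) (f : Fin r → ℂ) (m : Fin r → ℕ)
    (hq : q < ∑ i, m i) {l : ℕ} (hl : l ≤ q) :
    poch (-(q : ℂ)) l * charQzero q b f m l =
      ∑ k ∈ Finset.range ((∑ i, m i) + 1), Ccoeff f m k *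
        (poch (-(l : ℂ)) k * poch b k * poch (((∑ i, m i : ℕ) : ℂ) - q) (l - k)) := by
  have h0 : poch (-(q : ℂ)) l ≠ 0 := by
    rw [Ne, poch_eq_zero_iff, neg_neg]
    rintro ⟨k, hk, h⟩
    have : k = q := mod_cast h
    omega
  rw [charQzero, ← mul_assoc, mul_one_div_cancel h0, one_mul]
  rw [← Finset.sum_subset (Finset.range_mono (by omega : l + 1 ≤ (∑ i, m i) + 1))]
  · refine Finset.sum_congr rfl fun k _ => ?_
    ring
  · intro k _ hk
    rw [poch_neg_natCast_of_lt (by simpa using hk)]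
    ring

lemma continuous_poch (n : ℕ) : Continuous fun z => poch z n :=
  (ascPochhammer ℂ n).continuous

lemma tendsto_charQ {r : ℕ} {q : ℕ} (b : ℂ) (f : Fin r → ℂ) (m : Fin r → ℕ)
    (hq : q < ∑ i, m i) {l : ℕ} (hl : l ≤ q) :
    Filter.Tendsto (fun ε : ℂ => charQ b (b + ((∑ i, m i : ℕ) : ℂ) - q + ε) f m (-(l : ℂ)))
      (𝓝[≠] 0) (𝓝 (charQzero q b f m l)) := by
  set M := ∑ i, m i with hM
  have h0 : poch (-(q : ℂ)) l ≠ 0 := by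
    rw [Ne, poch_eq_zero_iff, neg_neg]
    rintro ⟨k, hk, h⟩
    have : k = q := mod_cast h
    omega
  have hcont : ContinuousAt (fun ε : ℂ => (1 / poch (-(q : ℂ) + ε) l) *
      ∑ k ∈ Finset.range (l + 1), poch b k * Ccoeff f m k * poch (-(l : ℂ)) k *
        poch ((M : ℂ) - q + ε) (l - k)) 0 := by
    refine ContinuousAt.mul (ContinuousAt.div continuousAt_const ?_ (by simpa using h0)) ?_
    · exact ((continuous_poch l).comp (by fun_prop)).continuousAt
    · refine Continuous.continuousAt (continuous_finsetSum _ fun k _ => continuous_const.mul ?_)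
      exact (continuous_poch (l - k)).comp (by fun_prop)
  have hlim := hcont.tendsto.mono_left (nhdsWithin_le_nhds (s := {(0 : ℂ)}ᶜ))
  simp only [add_zero] at hlim
  rw [charQzero]
  refine hlim.congr' ?_
  -- The zeros of `ε ↦ (ε - q)_M` are integers, so there are none with `0 < |ε| < 1`. There the
  -- common factor `(ε - q + l)_{M-l}`, which vanishes at `ε = 0`, cancels.
  filter_upwards [self_mem_nhdsWithin,
    mem_nhdsWithin_of_mem_nhds (Metric.ball_mem_nhds (0 : ℂ) one_pos)] with ε hε hε1
  have hε0 : ε ≠ 0 := hε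
  have hεn : ∀ n : ℤ, ε ≠ n := by
    rintro n rfl
    rw [mem_ball_zero_iff, Complex.norm_intCast] at hε1
    have : |n| < 1 := mod_cast hε1
    exact hε0 (by rw [Int.abs_lt_one_iff.1 this, Int.cast_zero])
  have hA : ∀ (j : ℤ) (n : ℕ), poch (j + ε) n ≠ 0 := by
    intro j n h
    obtain ⟨k, -, hk⟩ := (poch_eq_zero_iff _ _).1 h
    apply hεn (-(k : ℤ) - j)
    push_cast
    rw [hk]
    ring
  have hq' : poch (-(q : ℂ) + ε) l ≠ 0 := by simpa using hA (-(q : ℤ)) l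
  have hq'' : poch (-(q : ℂ) + ε + l) (M - l) ≠ 0 := by
    have := hA (-(q : ℤ) + l) (M - l)
    push_cast at this
    rwa [add_right_comm]
  rw [charQ, ← hM, show b + (M : ℂ) - q + ε - b - M = -(q : ℂ) + ε by ring, sub_neg_eq_add,
    show poch (-(q : ℂ) + ε) M = poch (-(q : ℂ) + ε) l * poch (-(q : ℂ) + ε + l) (M - l) by
      rw [← poch_add, Nat.add_sub_cancel' (by omega)],
    ← Finset.sum_subset (Finset.range_mono (by omega : l + 1 ≤ M + 1))]
  · rw [Finset.mul_sum, Finset.mul_sum]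
    refine Finset.sum_congr rfl fun k hk => ?_
    have hk : k ≤ l := Nat.lt_succ_iff.1 (Finset.mem_range.1 hk)
    have hsplit : poch (-(q : ℂ) + ε + l) (M - k) =
        poch (-(q : ℂ) + ε + l) (M - l) * poch ((M : ℂ) - q + ε) (l - k) := by
      rw [show M - k = (M - l) + (l - k) by omega, poch_add, Nat.cast_sub (by omega)]
      congr 2
      ring
    rw [hsplit]
    field_simp
  · intro k _ hk
    rw [poch_neg_natCast_of_lt (by simpa using hk)]
    ring

/-! ### Pfaff's substitution -/

/-- Substituting `x = y / (y - 1)` in `(1 - x) ^ a * ∑ c n * x ^ n` and rearranging into powers of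
`y`. The radius `1 / 8` is small enough for absolute convergence of the double series by the crude
bound of `norm_poch_le`. -/
lemma hasSum_pfaff {c : ℕ → ℂ} {F : ℂ → ℂ}
    (hF : ∀ z : ℂ, ‖z‖ < 1 → HasSum (fun n => c n * z ^ n) (F z)) (a : ℂ) {y : ℂ}
    (hy : ‖y‖ < 1 / 8) :
    HasSum (fun N => (∑ n ∈ Finset.range (N + 1), c n * (-1) ^ n *
        (poch (a + n) (N - n) / ((N - n).factorial : ℂ))) * y ^ N)
      ((1 - y / (y - 1)) ^ a * F (y / (y - 1))) := by
  have hy1 : ‖y‖ < 1 := by linarith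
  have hsl : 1 - y ∈ Complex.slitPlane := mem_cutPlane_iff.1 (mem_cutPlane_of_norm_lt_one hy1)
  have h1y : 1 - y ≠ 0 := Complex.slitPlane_ne_zero hsl
  have hy1' : y - 1 ≠ 0 := by
    rw [← neg_sub]
    exact neg_ne_zero.2 h1y
  have hpow : (1 - y / (y - 1)) ^ a = 1 / (1 - y) ^ a := by
    have : 1 - y / (y - 1) = (1 - y)⁻¹ := by
      field_simp
      ring
    rw [this, Complex.inv_cpow _ _ (Complex.mem_slitPlane_iff_arg.1 hsl).1, one_div]
  have hx : ‖y / (y - 1)‖ < 1 := by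
    have h2 : 1 - ‖y‖ ≤ ‖y - 1‖ := by
      rw [norm_sub_rev]
      simpa using norm_sub_norm_le (1 : ℂ) y
    rw [norm_div, div_lt_one (by linarith)]
    linarith
  set g : ℕ × ℕ → ℂ := fun p => c p.1 * (-1) ^ p.1 *
    (poch (a + p.1) p.2 / (p.2.factorial : ℂ)) * y ^ (p.1 + p.2) with hg
  -- the inner sums of the double series
  have hrow : ∀ n : ℕ, HasSum (fun k => g (n, k))
      (1 / (1 - y) ^ a * (c n * (y / (y - 1)) ^ n)) := by
    intro n
    have h2 := ((isCutContinuation_binomial (a + n)).2 y hy1).mul_left (c n * (-1) ^ n * y ^ n)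
    have h3 : c n * (-1) ^ n * y ^ n * (1 / (1 - y) ^ (a + n)) =
        1 / (1 - y) ^ a * (c n * (y / (y - 1)) ^ n) := by
      have h4 : (1 - y) ^ a ≠ 0 := by simp [Complex.cpow_eq_zero_iff, h1y]
      have h5 : y / (y - 1) = -1 * y / (1 - y) := by
        field_simp
        ring
      rw [Complex.cpow_add _ _ h1y, Complex.cpow_natCast, h5, div_pow, mul_pow]
      field_simp
    rw [h3] at h2
    refine h2.congr_fun fun k => ?_
    simp only [hg]
    rw [pow_add]
    ring
  have hsum : Summable g := by
    obtain ⟨K, hK⟩ := exists_nat_ge ‖a‖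
    have hA : Summable fun n => ‖c n * (2 * y) ^ n‖ := by
      refine (hF (2 * y) ?_).summable.norm
      rw [norm_mul, Complex.norm_ofNat]
      linarith
    have hB : Summable fun k : ℕ => 2 ^ K * (2 * ‖y‖) ^ k :=
      (summable_geometric_of_lt_one (by positivity) (by linarith)).mul_left _
    refine Summable.of_norm_bounded (hA.mul_of_nonneg hB (fun _ => norm_nonneg _)
      fun _ => by positivity) ?_
    rintro ⟨n, k⟩
    have h2 : ‖poch (a + n) k / (k.factorial : ℂ)‖ ≤ 2 ^ (K + n + k) := by
      have h3 : ‖poch (a + n) k‖ ≤ (k.factorial : ℝ) * 2 ^ (K + n + k) := by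
        refine norm_poch_le ((norm_add_le _ _).trans ?_) k
        rw [Complex.norm_natCast]
        push_cast
        gcongr
      rw [norm_div, Complex.norm_natCast, div_le_iff₀ (by positivity), mul_comm]
      exact h3
    simp only [hg, norm_mul, norm_pow, norm_neg, norm_one, one_pow, mul_one, Complex.norm_ofNat]
    calc ‖c n‖ * ‖poch (a + n) k / (k.factorial : ℂ)‖ * ‖y‖ ^ (n + k)
        ≤ ‖c n‖ * 2 ^ (K + n + k) * ‖y‖ ^ (n + k) := by gcongr
      _ = ‖c n‖ * (2 * ‖y‖) ^ n * (2 ^ K * (2 * ‖y‖) ^ k) := by ring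
  have htot : HasSum g ((1 - y / (y - 1)) ^ a * F (y / (y - 1))) := by
    have h2 := hsum.hasSum.prod_fiberwise hrow
    have h3 := (hF _ hx).mul_left (1 / (1 - y) ^ a)
    rw [hpow, ← h2.unique h3]
    exact hsum.hasSum
  have h2 := (Finset.HasAntidiagonal.sigmaAntidiagonalEquivProd.hasSum_iff.2 htot).sigma
    fun N => hasSum_fintype _
  refine h2.congr_fun fun N => ?_
  simp only [Function.comp_apply]
  refine Eq.trans ?_ (Finset.sum_coe_sort (Finset.HasAntidiagonal.antidiagonal N) g).symm
  rw [Finset.Nat.sum_antidiagonal_eq_sum_range_succ_mk, Finset.sum_mul]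
  refine Finset.sum_congr rfl fun n hn => ?_
  have hn : n ≤ N := Nat.lt_succ_iff.1 (Finset.mem_range.1 hn)
  simp only [hg]
  rw [Nat.add_sub_cancel' hn]

/-! ### The two hypergeometric functions -/

lemma prod_poch_div {r : ℕ} {f : Fin r → ℂ} (hf : ∀ i, ∀ n : ℕ, f i ≠ -(n : ℂ))
    (m : Fin r → ℕ) (n : ℕ) :
    (∏ i, poch (f i + m i) n) / (∏ i, poch (f i) n) =
      pochProd (fun i => f i + n) m / pochProd f m := by
  rw [pochProd, pochProd, ← Finset.prod_div_distrib, ← Finset.prod_div_distrib]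
  refine Finset.prod_congr rfl fun i _ => ?_
  rw [div_eq_div_iff (poch_ne_zero (hf i) _) (poch_ne_zero (hf i) _), mul_comm, ← poch_add,
    mul_comm, ← poch_add, add_comm]

lemma hypCoeff_lhs {r : ℕ} (q : ℕ) (a b : ℂ) {f : Fin r → ℂ}
    (hf : ∀ i, ∀ n : ℕ, f i ≠ -(n : ℂ)) (m : Fin r → ℕ) (n : ℕ) :
    hypCoeff (lhsTop a b f m) (lhsBot q b f m) n =
      poch a n * poch b n / (poch (b + ((∑ i, m i : ℕ) : ℂ) - q) n * (n.factorial : ℂ)) *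
        ∑ k ∈ Finset.range ((∑ i, m i) + 1), Ccoeff f m k * ((-1) ^ k * poch (-(n : ℂ)) k) := by
  rw [← pochProd_add_div, ← prod_poch_div hf]
  simp only [hypCoeff, lhsTop, lhsBot, Multiset.map_cons, Multiset.prod_cons, Multiset.map_map,
    Function.comp_def, Finset.prod_map_val]
  rw [div_mul_div_comm]
  congr 1 <;> ring

/-- The coefficients of `(1 - x) ^ a` times the hypergeometric function on the left, as a series in
`x / (x - 1)`. -/
lemma sum_hypCoeff_lhs {r : ℕ} {q : ℕ} (a b : ℂ) {f : Fin r → ℂ}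
    (hf : ∀ i, ∀ n : ℕ, f i ≠ -(n : ℂ)) (m : Fin r → ℕ)
    (hb : ∀ n : ℕ, b + ((∑ i, m i : ℕ) : ℂ) - q ≠ -(n : ℂ)) (N : ℕ) :
    ∑ n ∈ Finset.range (N + 1), hypCoeff (lhsTop a b f m) (lhsBot q b f m) n * (-1) ^ n *
        (poch (a + n) (N - n) / ((N - n).factorial : ℂ)) =
      poch a N / (poch (b + ((∑ i, m i : ℕ) : ℂ) - q) N * (N.factorial : ℂ)) *
        ∑ k ∈ Finset.range ((∑ i, m i) + 1), Ccoeff f m k *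
          (poch (-(N : ℂ)) k * poch b k * poch (((∑ i, m i : ℕ) : ℂ) - q) (N - k)) := by
  set M := ∑ i, m i with hM
  set c : ℂ := b + (M : ℂ) - q with hc
  have h1 : ∀ k, poch (-(N : ℂ)) k * poch b k * poch ((M : ℂ) - q) (N - k) =
      ∑ n ∈ Finset.range (N + 1), (N.choose n : ℂ) * (-1) ^ n * poch b n *
        poch (c + n) (N - n) * ((-1) ^ k * poch (-(n : ℂ)) k) := by
    intro k
    rw [sum_choose_poch_falling, hc, show b + (M : ℂ) - q - b = M - q by ring]
  simp_rw [h1, Finset.mul_sum]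
  rw [Finset.sum_comm]
  refine Finset.sum_congr rfl fun n hn => ?_
  have hn : n ≤ N := Nat.lt_succ_iff.1 (Finset.mem_range.1 hn)
  rw [hypCoeff_lhs q a b hf, ← hM, ← hc, Finset.mul_sum, Finset.sum_mul, Finset.sum_mul]
  refine Finset.sum_congr rfl fun k _ => ?_
  have ha : poch a N = poch a n * poch (a + n) (N - n) := by
    rw [← poch_add, Nat.add_sub_cancel' hn]
  have hcN : poch c N = poch c n * poch (c + n) (N - n) := by
    rw [← poch_add, Nat.add_sub_cancel' hn]
  have h2 := poch_ne_zero hb n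
  have h3 := poch_ne_zero (add_ne_neg_natCast hb n) (N - n)
  rw [ha, hcN, Nat.cast_choose ℂ hn]
  have h4 : (N.factorial : ℂ) ≠ 0 := Nat.cast_ne_zero.2 N.factorial_ne_zero
  have h5 : (n.factorial : ℂ) ≠ 0 := Nat.cast_ne_zero.2 n.factorial_ne_zero
  have h6 : ((N - n).factorial : ℂ) ≠ 0 := Nat.cast_ne_zero.2 (N - n).factorial_ne_zero
  field_simp

/-- The coefficients of the function on the right: up to normalization, the parameters coming from
the zeros of the reduced polynomial contribute its values at `-q-1-s`. -/
lemma eval_reducedR_mul_hypCoeff_rhs {r : ℕ} (q : ℕ) (a b : ℂ) (f : Fin r → ℂ) (m : Fin r → ℕ)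
    (hl : ∀ l ∈ (reducedR q b f m).roots, ∀ n : ℕ, l + (q : ℂ) + 1 ≠ -(n : ℂ)) (s : ℕ) :
    (reducedR q b f m).eval (-(q : ℂ) - 1) * hypCoeff (rhsTop q a b f m) (rhsBot q b f m) s =
      poch (a + q + 1) s / poch (b + ((∑ i, m i : ℕ) : ℂ) + 1) s *
        (reducedR q b f m).eval (-((q + 1 + s : ℕ) : ℂ)) := by
  have h1 := eval_mul_prod_roots (reducedR q b f m) ((q : ℂ) + 1)
    (by simpa only [add_assoc] using hl) s
  rw [show -((q : ℂ) + 1) - s = -((q + 1 + s : ℕ) : ℂ) by push_cast; ring, neg_add'] at h1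
  rw [← h1]
  have hs : (s.factorial : ℂ) ≠ 0 := Nat.cast_ne_zero.2 s.factorial_ne_zero
  simp only [hypCoeff, rhsTop, rhsBot, Multiset.map_cons, Multiset.prod_cons, Multiset.map_map,
    Function.comp_def, poch_one, ← add_assoc]
  simp only [show ∀ l : ℂ, l + q + 1 + 1 = l + q + 2 from fun l => by ring]
  field_simp

lemma card_lhsTop {r : ℕ} (q : ℕ) (a b : ℂ) (f : Fin r → ℂ) (m : Fin r → ℕ) :
    (lhsTop a b f m).card = (lhsBot q b f m).card + 1 := by
  simp [lhsTop, lhsBot]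

lemma card_rhsTop {r : ℕ} (q : ℕ) (a b : ℂ) (f : Fin r → ℂ) (m : Fin r → ℕ) :
    (rhsTop q a b f m).card = (rhsBot q b f m).card + 1 := by
  simp [rhsTop, rhsBot]

/-- The transformation formula in terms of holomorphic continuations `F` and `H` of the two
hypergeometric series. -/
lemma pfaff_transformation {r : ℕ} {q : ℕ} (a b : ℂ) {f : Fin r → ℂ} (m : Fin r → ℕ)
    (hq : q < ∑ i, m i) (hf : ∀ i, ∀ n : ℕ, f i ≠ -(n : ℂ))
    (hb : ∀ n : ℕ, b + ((∑ i, m i : ℕ) : ℂ) - q ≠ -(n : ℂ))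
    (hl : ∀ l ∈ (reducedR q b f m).roots, ∀ n : ℕ, l + (q : ℂ) + 1 ≠ -(n : ℂ))
    {F H : ℂ → ℂ} (hF : IsHypContinuation (lhsTop a b f m) (lhsBot q b f m) F)
    (hH : IsHypContinuation (rhsTop q a b f m) (rhsBot q b f m) H) {x : ℂ} (hx : x ∈ cutPlane) :
    (1 - x) ^ a * F x =
      ∑ j ∈ Finset.range (q + 1),
        poch a j * poch (-(q : ℂ)) j * charQzero q b f m j /
          (poch (b + ((∑ i, m i : ℕ) : ℂ) - q) j * (j.factorial : ℂ)) * (x / (x - 1)) ^ j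
      + x ^ (q + 1) * poch a (q + 1) * (reducedR q b f m).eval (-(q : ℂ) - 1) /
          ((x - 1) ^ (q + 1) * poch (b + ((∑ i, m i : ℕ) : ℂ) - q) (q + 1) *
            (((∑ i, m i) - q - 1).factorial : ℂ)) * H (x / (x - 1)) := by
  set M := ∑ i, m i with hM
  set c : ℂ := b + (M : ℂ) - q with hc
  -- the common coefficients of both sides as series in `x / (x - 1)`
  set g : ℕ → ℂ := fun N => poch a N / (poch c N * (N.factorial : ℂ)) *
    ∑ k ∈ Finset.range (M + 1), Ccoeff f m k *
      (poch (-(N : ℂ)) k * poch b k * poch ((M : ℂ) - q) (N - k)) with hg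
  set A : ℂ := poch a (q + 1) * (reducedR q b f m).eval (-(q : ℂ) - 1) /
    (poch c (q + 1) * ((M - q - 1).factorial : ℂ)) with hA
  have hghead : ∀ j ∈ Finset.range (q + 1), g j =
      poch a j * poch (-(q : ℂ)) j * charQzero q b f m j / (poch c j * (j.factorial : ℂ)) := by
    intro j hj
    rw [mul_assoc, poch_mul_charQzero b f m hq (Nat.lt_succ_iff.1 (Finset.mem_range.1 hj)),
      mul_div_right_comm]
  have hgtail : ∀ s, g (s + (q + 1)) = A * hypCoeff (rhsTop q a b f m) (rhsBot q b f m) s := by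
    intro s
    have h1 := sum_poch_eq_eval_reducedR b f m hq (Nat.le_add_left (q + 1) s)
    have h2 := eval_reducedR_mul_hypCoeff_rhs q a b f m hl s
    have hfac : ((M - q - 1).factorial : ℂ) ≠ 0 := Nat.cast_ne_zero.2 (Nat.factorial_ne_zero _)
    have hfac' : ((s + (q + 1)).factorial : ℂ) ≠ 0 := Nat.cast_ne_zero.2 (Nat.factorial_ne_zero _)
    have hsplit : poch c (s + (q + 1)) = poch c (q + 1) * poch (b + (M : ℂ) + 1) s := by
      rw [add_comm s, poch_add]
      congr 2
      push_cast
      rw [hc]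
      ring
    have hsplit' : poch a (s + (q + 1)) = poch a (q + 1) * poch (a + q + 1) s := by
      rw [add_comm s, poch_add]
      congr 2
      push_cast
      ring
    rw [← eq_div_iff hfac] at h1
    rw [add_comm (q + 1) s] at h2
    have h3 : A * hypCoeff (rhsTop q a b f m) (rhsBot q b f m) s = poch a (q + 1) /
        (poch c (q + 1) * ((M - q - 1).factorial : ℂ)) * ((reducedR q b f m).eval (-(q : ℂ) - 1) *
          hypCoeff (rhsTop q a b f m) (rhsBot q b f m) s) := by
      rw [hA]
      ring
    simp only [hg]
    rw [h3, h2, h1, hsplit, hsplit', ← hM]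
    have h4 := poch_ne_zero hb (q + 1)
    have h5 : poch (b + (M : ℂ) + 1) s ≠ 0 := by
      have := poch_ne_zero (add_ne_neg_natCast hb (q + 1)) s
      push_cast at this
      rwa [show b + (M : ℂ) - q + (q + 1) = b + M + 1 by ring] at this
    field_simp
  have hrhs : ∀ y : ℂ, ‖y‖ < 1 → HasSum (fun N => g N * y ^ N)
      (∑ j ∈ Finset.range (q + 1), poch a j * poch (-(q : ℂ)) j * charQzero q b f m j /
        (poch c j * (j.factorial : ℂ)) * y ^ j + A * y ^ (q + 1) * H y) := by
    intro y hy
    rw [add_comm, Finset.sum_congr rfl fun j hj => by rw [← hghead j hj], ← hasSum_nat_add_iff]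
    refine ((hH.2 y hy).mul_left (A * y ^ (q + 1))).congr_fun fun s => ?_
    rw [hgtail, pow_add]
    ring
  have hlhs : ∀ y : ℂ, ‖y‖ < 1 / 8 → HasSum (fun N => g N * y ^ N)
      ((1 - y / (y - 1)) ^ a * F (y / (y - 1))) := by
    intro y hy
    refine (hasSum_pfaff hF.2 a hy).congr_fun fun N => ?_
    rw [sum_hypCoeff_lhs a b hf m hb]
  have hne : ∀ z ∈ cutPlane, z - 1 ≠ 0 := fun z hz => sub_ne_zero.2 (ne_one_of_mem_cutPlane hz)
  have hdiv : DifferentiableOn ℂ (fun z : ℂ => z / (z - 1)) cutPlane :=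
    DifferentiableOn.fun_div (by fun_prop) (by fun_prop) hne
  have hanL : AnalyticOnNhd ℂ (fun z => (1 - z) ^ a * F z) cutPlane := by
    refine DifferentiableOn.analyticOnNhd (DifferentiableOn.mul (fun z hz => ?_) hF.1)
      isOpen_cutPlane
    exact (DifferentiableAt.cpow (by fun_prop) (by fun_prop)
      (mem_cutPlane_iff.1 hz)).differentiableWithinAt
  have hanR : AnalyticOnNhd ℂ (fun z => ∑ j ∈ Finset.range (q + 1),
      poch a j * poch (-(q : ℂ)) j * charQzero q b f m j / (poch c j * (j.factorial : ℂ)) *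
        (z / (z - 1)) ^ j + A * (z / (z - 1)) ^ (q + 1) * H (z / (z - 1))) cutPlane := by
    refine DifferentiableOn.analyticOnNhd (DifferentiableOn.add ?_ (DifferentiableOn.mul ?_ ?_))
      isOpen_cutPlane
    · exact DifferentiableOn.fun_sum fun j _ => (hdiv.pow j).const_mul _
    · exact (hdiv.pow _).const_mul _
    · exact hH.1.comp hdiv fun z hz => div_sub_one_mem_cutPlane hz
  have key := hanL.eqOn_of_preconnected_of_eventuallyEq hanR isPreconnected_cutPlane
    zero_mem_cutPlane (by
      have hcont : ContinuousAt (fun z : ℂ => z / (z - 1)) 0 :=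
        (hdiv.differentiableAt (isOpen_cutPlane.mem_nhds zero_mem_cutPlane)).continuousAt
      have hball : ∀ᶠ z : ℂ in 𝓝 0, ‖z / (z - 1)‖ < 1 / 8 := by
        have := hcont.norm.eventually_lt_const (u := 1 / 8) (by norm_num)
        exact this
      filter_upwards [hball, isOpen_cutPlane.mem_nhds zero_mem_cutPlane] with z hz hzc
      have h1 := hlhs _ hz
      -- `x ↦ x / (x - 1)` is an involution
      have hinv : z / (z - 1) / (z / (z - 1) - 1) = z := by
        have h2 := hne z hzc
        have h3 : z / (z - 1) - 1 = 1 / (z - 1) := by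
          field_simp
          ring
        rw [h3]
        field_simp
      rw [hinv] at h1
      exact h1.unique (hrhs _ (by linarith))) hx
  have h1 := hne x hx
  simp only at key
  rw [key, hA, div_pow]
  congr 1
  rw [show x ^ (q + 1) * poch a (q + 1) * (reducedR q b f m).eval (-(q : ℂ) - 1) =
      poch a (q + 1) * (reducedR q b f m).eval (-(q : ℂ) - 1) * x ^ (q + 1) by ring,
    div_mul_div_comm, mul_assoc ((x - 1) ^ (q + 1)), mul_comm ((x - 1) ^ (q + 1))]

theorem theorem1 {r : ℕ} (m : Fin r → ℕ) (hm : ∀ i, 0 < m i)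
    (M : ℕ) (hM : M = ∑ i, m i)
    (a b : ℂ) (f : Fin r → ℂ)
    (q : ℕ) (hq : q < M)
    -- the bottom parameters on the left are not non-positive integers
    (hf : ∀ i, ∀ n : ℕ, f i ≠ -(n : ℂ))
    (hb : ∀ n : ℕ, b + (M : ℂ) - q ≠ -(n : ℂ))
    (hfb : ∀ j, (M : ℤ) - q - m j ≤ 0 →
      ∀ i : ℤ, (M : ℤ) - q - m j ≤ i → i ≤ 0 → f j - b ≠ (i : ℂ))
    -- neither are those on the right
    (hl : ∀ l ∈ (reducedR q b f m).roots, ∀ n : ℕ, l + (q : ℂ) + 1 ≠ -(n : ℂ)) :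
    -- both hypergeometric functions exist on the cut plane
    IsHypContinuation (lhsTop a b f m) (lhsBot q b f m)
        (pFq (lhsTop a b f m) (lhsBot q b f m)) ∧
    IsHypContinuation (rhsTop q a b f m) (rhsBot q b f m)
        (pFq (rhsTop q a b f m) (rhsBot q b f m)) ∧
    -- the transformation
    (∀ x ∈ cutPlane,
      (1 - x) ^ a * pFq (lhsTop a b f m) (lhsBot q b f m) x =
        ∑ j ∈ Finset.range (q + 1),
          poch a j * poch (-(q : ℂ)) j * charQzero q b f m j /
            (poch (b + (M : ℂ) - q) j * (j.factorial : ℂ)) * (x / (x - 1)) ^ j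
        + x ^ (q + 1) * poch a (q + 1) * (reducedR q b f m).eval (-(q : ℂ) - 1) /
            ((x - 1) ^ (q + 1) * poch (b + (M : ℂ) - q) (q + 1) *
              ((M - q - 1).factorial : ℂ)) *
          pFq (rhsTop q a b f m) (rhsBot q b f m) (x / (x - 1))) ∧
    -- the numbers `Q_m^0(-l)` are the limits of `Q_m(b, b + m - q + ε, f | -l)`
    (∀ l ≤ q, Filter.Tendsto
      (fun ε : ℂ => charQ b (b + (M : ℂ) - q + ε) f m (-(l : ℂ)))
      (𝓝[≠] 0) (𝓝 (charQzero q b f m l))) ∧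
    -- the degree of the reduced polynomial
    (reducedR q b f m).degree ≤ ((M - q - 1 : ℕ) : WithBot ℕ) ∧
    ((reducedR q b f m).degree = ((M - q - 1 : ℕ) : WithBot ℕ) ↔
      ∀ j, ∀ i : ℕ, i < m j → f j - b ≠ -(i : ℂ)) ∧
    -- the value of the reduced polynomial at `-q-1`
    (reducedR q b f m).eval (-(q : ℂ) - 1) =
      (-1) ^ (M - q + 1) *
        ∑ k ∈ Finset.range (q + 2),
          poch b k * Ccoeff f m k * (-1) ^ k * poch ((k : ℂ) - M) (M - q - 1) := by
  subst hM
  have hF := isHypContinuation_pFq (lhsTop a b f m) (lhsBot q b f m) (card_lhsTop q a b f m) (by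
    intro β hβ n
    rcases Multiset.mem_cons.1 hβ with rfl | hβ
    · exact hb n
    · obtain ⟨i, -, rfl⟩ := Multiset.mem_map.1 hβ
      exact hf i n)
  have hH := isHypContinuation_pFq (rhsTop q a b f m) (rhsBot q b f m) (card_rhsTop q a b f m) (by
    intro β hβ n
    rcases Multiset.mem_cons.1 hβ with rfl | hβ
    · have := add_ne_neg_natCast hb (q + 1) n
      rw [Nat.cast_add_one] at this
      rwa [show b + ((∑ i, m i : ℕ) : ℂ) - q + (q + 1) = b + ((∑ i, m i : ℕ) : ℂ) + 1 by ring]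
        at this
    · obtain ⟨l, hlr, rfl⟩ := Multiset.mem_map.1 hβ
      exact hl l hlr n)
  exact ⟨hF, hH, fun x hx => pfaff_transformation a b m hq hf hb hl hF hH hx,
    fun l hlq => tendsto_charQ b f m hq hlq,
    Polynomial.natDegree_le_iff_degree_le.1 (natDegree_reducedR_le q b f m),
    degree_reducedR_eq_iff q b m hf, eval_reducedR_neg_sub_one b f m hq⟩
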